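/- **Setting.** Consider $x(k+1)=Ax(k)+w(k)$, $y(k)=Cx(k)+v(k)+a(k)$, $k\ge 0$, with $n$ states and $m$ sensors; $C_i$ is the $i$-th row of $C$ and $'$ is the conjugate transpose. The noises $w(k),v(k)$ have covariances $Q\succeq 0$, $R\succ 0$, and $x(0)$ has covariance $\Sigma\succeq 0$. The matrix $A$ is non-singular and in Jordan canonical form, with different Jordan blocks belonging to different eigenvalues (the coordinates may be complex). Let $P(k|k-1)$, $P(k)$ be the covariances of the Kalman filter: $P(0|-1)=\Sigma$, $P(k)=P(k|k-1)-K(k)CP(k|k-1)$ with $K(k)=P(k|k-1)C'(CP(k|k-1)C'+R)^{-1}$, and $P(k+1|k)=AP(k)A'+Q$. Let $P=\lim_k P(k)$ (assumed to exist), $P_+=APA'+Q$, $K=P_+C'(CP_+C'+R)^{-1}$. Assume that $A-KCA=V\Pi V^{-1}$ with $\Pi=\mathrm{diag}(\pi_1,\dots,\pi_n)$ has $n$ distinct eigenvalues, none of which is an eigenvalue of $A$. For each sensor $i$: * $G_i$ is the $n\times n$ matrix with rows $C_iA(A-\pi_jI)^{-1}$, $j=1,\dots,n$; * $H_i$ is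 the diagonal $0/1$ matrix whose $j$-th diagonal entry is $1$ iff the $j$-th column of the observability matrix of $(A,C_i)$ (rows $C_iA^t$, $0\le t<n$) is non-zero; * $P_i$ is an invertible matrix with $P_iG_i=H_i$; * $F_i=V\,\mathrm{diag}(V^{-1}K_i)$, where $K_i$ is the $i$-th column of $K$. Put $G=[G_1;\dots;G_m]$ and $H=[H_1;\dots;H_m]$ (stacked vertically), $F=[F_1,\dots,F_m]$, $\tilde P=\mathrm{diag}(P_1,\dots,P_m)$, $\tilde\Pi=\mathrm{diag}(\Pi,\dots,\Pi)$, let $\tilde W$ solve $\tilde W=\tilde\Pi\tilde W\tilde\Pi'+\tilde Q$ with $\tilde Q=LQL'+R\otimes \mathbf 1_{n\times n}$, $L=[G_1-\mathbf 1_nC_1;\dots;G_m-\mathbf 1_nC_m]$, and let $\tilde M=\tilde P\tilde W\tilde P'$. The local estimates satisfy $\zeta_i(k+1)=\Pi\zeta_i(k)+\mathbf 1_n y_i(k+1)$, the fixed-gain Kalman estimate satisfies $\hat x(k+1)=(A-KCA)\hat x(k)+Ky(k+1)$, and they are initialised consistently, $\hat x(0)=\sum_iF_i\zeta_i(0)$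 (for instance $\hat x(0)=Ky(0)$ and $\zeta_i(0)=\mathbf 1_n y_i(0)$, or all zero). Let $\epsilon_i(k)=\zeta_i(k)-G_ix(k)$, let $\epsilon(k)$ be the stacked vector, and $\mathcal Y(k)=[P_1\zeta_1(k);\dots;P_m\zeta_m(k)]$. The proposed estimate is the component $\tilde x$ of a solution of $$\min_{\tilde x,\mu,\nu}\ \tfrac12\,\mu'\tilde M^{-1}\mu+\gamma\|\nu\|_1\quad\text{subject to}\quad \mathcal Y(k)=H\tilde x+\mu+\nu .$$ **Theorem.** Suppose there is no attack, $a(k)=0$ for all $k$. For every realisation of the system and every $k$, if $$\bigl\|\tilde M^{-1}\tilde P\,(I-GF)\,\epsilon(k)\bigr\|_\infty\le\gamma ,$$ then the problem has a solution with $\tilde x=\hat x(k)$; and if moreover $\gamma>0$, every solution $(\tilde x,\mu,\nu)$ of the problem has $\tilde x=\hat x(k)$. -/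

import Mathlib

open Filter Topology
open scoped Matrix Kronecker ComplexOrder

noncomputable section

namespace SecureKalman

/-- The upper Jordan block of size `d` with eigenvalue `a`. -/
def jordanBlock (d : ℕ) (a : ℂ) : Matrix (Fin d) (Fin d) ℂ :=
  Matrix.of fun r s => if s = r then a else if (s : ℕ) = (r : ℕ) + 1 then 1 else 0

/-- `A` is a block diagonal matrix `diag (J₁, …, J_l)` of upper Jordan blocks which belong to
pairwise different eigenvalues (so every eigenvalue of `A` has geometric multiplicity one). -/
def IsNonderogatoryJordan {n : ℕ} (A : Matrix (Fin n) (Fin n) ℂ) : Prop :=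
  ∃ (l : ℕ) (d : Fin l → ℕ) (lam : Fin l → ℂ) (hd : ∑ b, d b = n),
    Function.Injective lam ∧
    A = Matrix.reindex (finSigmaFinEquiv.trans (finCongr hd))
      (finSigmaFinEquiv.trans (finCongr hd))
      (Matrix.blockDiagonal' fun b => jordanBlock (d b) (lam b))

variable {n m : ℕ}

/-- The Kalman gain `S C' (C S C' + R)⁻¹` for the prediction covariance `S`. -/
def kalmanGain (C : Matrix (Fin m) (Fin n) ℂ) (R : Matrix (Fin m) (Fin m) ℂ)
    (S : Matrix (Fin n) (Fin n) ℂ) : Matrix (Fin n) (Fin m) ℂ :=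
  S * Cᴴ * (C * S * Cᴴ + R)⁻¹

/-- The measurement update `S - K C S` of the prediction covariance `S`. -/
def measurementUpdate (C : Matrix (Fin m) (Fin n) ℂ) (R : Matrix (Fin m) (Fin m) ℂ)
    (S : Matrix (Fin n) (Fin n) ℂ) : Matrix (Fin n) (Fin n) ℂ :=
  S - kalmanGain C R S * C * S

/-- The prediction covariances `P(k | k-1)` of the Kalman filter, with `P(0 | -1) = Σ₀`. -/
def predictionCov (A : Matrix (Fin n) (Fin n) ℂ) (C : Matrix (Fin m) (Fin n) ℂ)
    (Q : Matrix (Fin n) (Fin n) ℂ) (R : Matrix (Fin m) (Fin m) ℂ)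
    (Sig : Matrix (Fin n) (Fin n) ℂ) : ℕ → Matrix (Fin n) (Fin n) ℂ
  | 0 => Sig
  | k + 1 => A * measurementUpdate C R (predictionCov A C Q R Sig k) * Aᴴ + Q

/-- The estimation error covariances `P(k)` of the Kalman filter. -/
def errorCov (A : Matrix (Fin n) (Fin n) ℂ) (C : Matrix (Fin m) (Fin n) ℂ)
    (Q : Matrix (Fin n) (Fin n) ℂ) (R : Matrix (Fin m) (Fin m) ℂ)
    (Sig : Matrix (Fin n) (Fin n) ℂ) (k : ℕ) : Matrix (Fin n) (Fin n) ℂ :=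
  measurementUpdate C R (predictionCov A C Q R Sig k)

/-- The matrix `G_i` of sensor `i`; its `j`-th row is `C_i A (A - π_j I)⁻¹`. -/
def sensorG (A : Matrix (Fin n) (Fin n) ℂ) (C : Matrix (Fin m) (Fin n) ℂ) (pi : Fin n → ℂ)
    (i : Fin m) : Matrix (Fin n) (Fin n) ℂ :=
  Matrix.of fun j => C i ᵥ* (A * (A - pi j • (1 : Matrix (Fin n) (Fin n) ℂ))⁻¹)

/-- The observability matrix `O_i` of `(A, C_i)`, with rows `C_i, C_i A, …, C_i A ^ (n-1)`. -/
def observabilityMatrix (A : Matrix (Fin n) (Fin n) ℂ) (C : Matrix (Fin m) (Fin n) ℂ)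
    (i : Fin m) : Matrix (Fin n) (Fin n) ℂ :=
  Matrix.of fun t => C i ᵥ* A ^ (t : ℕ)

/-- The set `S_j` of the sensors that can observe state `j`: the `j`-th column of the
observability matrix of the sensor is not zero. -/
def observers (A : Matrix (Fin n) (Fin n) ℂ) (C : Matrix (Fin m) (Fin n) ℂ) (j : Fin n) :
    Set (Fin m) :=
  {i | observabilityMatrix A C i *ᵥ Pi.single j 1 ≠ 0}

open Classical in
/-- The canonical form `H_i`, the diagonal matrix with `j`-th entry the indicator of
`i ∈ S_j`. -/
def sensorH (A : Matrix (Fin n) (Fin n) ℂ) (C : Matrix (Fin m) (Fin n) ℂ) (i : Fin m) :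
    Matrix (Fin n) (Fin n) ℂ :=
  Matrix.diagonal fun j => if i ∈ observers A C j then 1 else 0

/-- The column of blocks `[B_1; …; B_m]`. -/
def stackRows (B : Fin m → Matrix (Fin n) (Fin n) ℂ) : Matrix (Fin m × Fin n) (Fin n) ℂ :=
  Matrix.of fun p s => B p.1 p.2 s

/-- The row of blocks `[B_1, …, B_m]`. -/
def stackCols (B : Fin m → Matrix (Fin n) (Fin n) ℂ) : Matrix (Fin n) (Fin m × Fin n) ℂ :=
  Matrix.of fun r p => B p.1 r p.2

/-- The block diagonal matrix `diag (B_1, …, B_m)`; an index is (block, entry in the block). -/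
def blockDiag (B : Fin m → Matrix (Fin n) (Fin n) ℂ) :
    Matrix (Fin m × Fin n) (Fin m × Fin n) ℂ :=
  Matrix.of fun p q => if p.1 = q.1 then B p.1 p.2 q.2 else 0

/-- The stacked vector `[u_1; …; u_m]`. -/
def stackVec (u : Fin m → Fin n → ℂ) : Fin m × Fin n → ℂ := fun p => u p.1 p.2

/-- `G = [G_1; …; G_m]`. -/
def bigG (A : Matrix (Fin n) (Fin n) ℂ) (C : Matrix (Fin m) (Fin n) ℂ) (pi : Fin n → ℂ) :
    Matrix (Fin m × Fin n) (Fin n) ℂ :=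
  stackRows (sensorG A C pi)

/-- `H = [H_1; …; H_m]`. -/
def bigH (A : Matrix (Fin n) (Fin n) ℂ) (C : Matrix (Fin m) (Fin n) ℂ) :
    Matrix (Fin m × Fin n) (Fin n) ℂ :=
  stackRows (sensorH A C)

/-- `F = [F_1, …, F_m]` with `F_i = V diag(V⁻¹ K_i)`, where `K_i` is the `i`-th column of `K`. -/
def bigF (V : Matrix (Fin n) (Fin n) ℂ) (K : Matrix (Fin n) (Fin m) ℂ) :
    Matrix (Fin n) (Fin m × Fin n) ℂ :=
  stackCols fun i => V * Matrix.diagonal (V⁻¹ *ᵥ fun r => K r i)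

/-- The covariance `Q̃ = L Q L' + R ⊗ 1_{n×n}`, where `L = [G_1 - 1_n C_1; …; G_m - 1_n C_m]`. -/
def noiseCov (A : Matrix (Fin n) (Fin n) ℂ) (C : Matrix (Fin m) (Fin n) ℂ)
    (Q : Matrix (Fin n) (Fin n) ℂ) (R : Matrix (Fin m) (Fin m) ℂ) (pi : Fin n → ℂ) :
    Matrix (Fin m × Fin n) (Fin m × Fin n) ℂ :=
  let L : Matrix (Fin m × Fin n) (Fin n) ℂ :=
    stackRows fun i => sensorG A C pi i - Matrix.vecMulVec (fun _ => 1) (C i)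
  L * Q * Lᴴ + R ⊗ₖ (Matrix.of fun _ _ => 1 : Matrix (Fin n) (Fin n) ℂ)

/-- The cost `(1/2) μ' M⁻¹ μ + γ ‖ν‖₁`. -/
def lassoCost (M : Matrix (Fin m × Fin n) (Fin m × Fin n) ℂ) (γ : ℝ)
    (μ ν : Fin m × Fin n → ℂ) : ℝ :=
  1 / 2 * (star μ ⬝ᵥ (M⁻¹ *ᵥ μ)).re + γ * ∑ p, ‖ν p‖

/-- `(x, μ, ν)` solves the problem: minimise `(1/2) μ' M⁻¹ μ + γ ‖ν‖₁` subject to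
`Y = H x + μ + ν`. -/
structure IsLassoSolution (M : Matrix (Fin m × Fin n) (Fin m × Fin n) ℂ)
    (H : Matrix (Fin m × Fin n) (Fin n) ℂ) (Y : Fin m × Fin n → ℂ) (γ : ℝ)
    (x : Fin n → ℂ) (μ ν : Fin m × Fin n → ℂ) : Prop where
  feasible : Y = H *ᵥ x + μ + ν
  minimal : ∀ (x' : Fin n → ℂ) (μ' ν' : Fin m × Fin n → ℂ),
    Y = H *ᵥ x' + μ' + ν' → lassoCost M γ μ ν ≤ lassoCost M γ μ' ν'

end SecureKalman

end

namespace SecureKalman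

/-! Write N = A - KCA, let D be the block diagonal matrix of copies of Π, and let E be the matrix
repeating the i-th entry over block i (`blockRepeat`). The relation GA = DG + ECA makes the residues
evolve independently of x, as ε(k+1) = Dε(k) + (EC - G)w(k) + Ev(k+1); this is where the Lyapunov
equation for W comes from. Dually, FE = K and FD = NF, so Fζ obeys the Kalman recursion and x̂ = Fζ
(`bigF_mulVec_stackVec_eq`). Moreover FG = 1, since FG - 1 intertwines A and N, whose spectra are
disjoint (`bigF_mul_bigG`). Hence ζ - Gx̂ = (1 - GF)ζ = (1 - GF)ε.

The heart is W F' = G P (`stationaryCov_mul_bigF`): both sides solve one Sylvester equation, whose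
solution is unique because all |π_j| < 1. Together with FG = 1 it gives G' W⁻¹ (1 - GF) = 0, so x̂
is the least squares fit of ζ by G with weight W⁻¹.

The invertible `blockDiag T` carries this over to H and M. Thus ν = 0 and μ = T(1 - GF)ε satisfy the
optimality conditions: H' M⁻¹ μ = 0, and the bound by γ makes M⁻¹ μ a subgradient of γ‖·‖₁ at 0.
Uniqueness comes from strict convexity in μ, then γ > 0, then injectivity of H. -/

theorem tendsto_posSemidef {ι : Type*} [Fintype ι] {f : ℕ → Matrix ι ι ℂ} {P : Matrix ι ι ℂ}
    (hf : ∀ k, (f k).PosSemidef) (hP : Tendsto f atTop (𝓝 P)) : P.PosSemidef := by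
  refine Matrix.PosSemidef.of_dotProduct_mulVec_nonneg ?_ fun z => ?_
  · have h1 : Tendsto (fun k => (f k)ᴴ) atTop (𝓝 Pᴴ) :=
      (continuous_id.matrix_conjTranspose.tendsto P).comp hP
    have h2 : (fun k => (f k)ᴴ) = f := funext fun k => (hf k).isHermitian
    rw [h2] at h1
    exact tendsto_nhds_unique h1 hP
  · have hc : Continuous fun X : Matrix ι ι ℂ => star z ⬝ᵥ (X *ᵥ z) :=
      continuous_const.dotProduct (continuous_id.matrix_mulVec continuous_const)
    exact ge_of_tendsto' ((hc.tendsto P).comp hP) fun k => (hf k).dotProduct_mulVec_nonneg z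

/-! ### Steady-state identities of the Kalman filter -/

section Kalman

variable {n m : ℕ} {C : Matrix (Fin m) (Fin n) ℂ} {R : Matrix (Fin m) (Fin m) ℂ}
  {S : Matrix (Fin n) (Fin n) ℂ}

theorem isUnit_det_innovationCov (hR : R.PosDef) (hS : S.PosSemidef) :
    IsUnit (C * S * Cᴴ + R).det :=
  (Matrix.isUnit_iff_isUnit_det _).1
    (Matrix.PosDef.posSemidef_add (hS.mul_mul_conjTranspose_same C) hR).isUnit

/-- Rearranging K(CSC' + R) = SC' gives it. Both the Joseph form and the output identity CP = RK'
rest on it. -/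
theorem kalmanGain_mul_cov (hR : R.PosDef) (hS : S.PosSemidef) :
    kalmanGain C R S * R = measurementUpdate C R S * Cᴴ := by
  have h : kalmanGain C R S * (C * S * Cᴴ + R) = S * Cᴴ := by
    rw [kalmanGain, Matrix.nonsing_inv_mul_cancel_right _ _ (isUnit_det_innovationCov hR hS)]
  rw [measurementUpdate, Matrix.sub_mul, ← h]
  simp only [Matrix.mul_add, Matrix.mul_assoc]
  abel

theorem measurementUpdate_eq : measurementUpdate C R S = (1 - kalmanGain C R S * C) * S := by
  rw [measurementUpdate, sub_mul, one_mul]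

/-- The Joseph form of the measurement update. -/
theorem measurementUpdate_eq_joseph (hR : R.PosDef) (hS : S.PosSemidef) :
    measurementUpdate C R S = (1 - kalmanGain C R S * C) * S * (1 - kalmanGain C R S * C)ᴴ +
      kalmanGain C R S * R * (kalmanGain C R S)ᴴ := by
  rw [kalmanGain_mul_cov hR hS, ← measurementUpdate_eq, Matrix.conjTranspose_sub,
    Matrix.conjTranspose_one, Matrix.conjTranspose_mul, mul_sub, mul_one, Matrix.mul_assoc]
  abel

theorem measurementUpdate_posSemidef (hR : R.PosDef) (hS : S.PosSemidef) :
    (measurementUpdate C R S).PosSemidef := by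
  rw [measurementUpdate_eq_joseph hR hS]
  exact (hS.mul_mul_conjTranspose_same _).add (hR.posSemidef.mul_mul_conjTranspose_same _)

theorem continuousAt_measurementUpdate (hR : R.PosDef) (hS : S.PosSemidef) :
    ContinuousAt (measurementUpdate C R) S := by
  have h0 : Continuous fun X : Matrix (Fin n) (Fin n) ℂ => C * X * Cᴴ + R := by fun_prop
  have h1 : ContinuousAt (fun X : Matrix (Fin n) (Fin n) ℂ => (C * X * Cᴴ + R)⁻¹) S := by
    refine ContinuousAt.comp (g := fun Y : Matrix (Fin m) (Fin m) ℂ => Y⁻¹) ?_ h0.continuousAt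
    refine continuousAt_matrix_inv _ ?_
    rw [Ring.inverse_eq_inv']
    exact continuousAt_inv₀ (isUnit_det_innovationCov hR hS).ne_zero
  have h2 : ContinuousAt (fun X : Matrix (Fin n) (Fin n) ℂ => X) S := continuousAt_id
  have h3 : ContinuousAt (fun X : Matrix (Fin n) (Fin n) ℂ => X * Cᴴ) S :=
    (continuous_id.matrix_mul continuous_const).continuousAt
  have mulc : ∀ {a b c : ℕ} {f : Matrix (Fin n) (Fin n) ℂ → Matrix (Fin a) (Fin b) ℂ}
      {g : Matrix (Fin n) (Fin n) ℂ → Matrix (Fin b) (Fin c) ℂ},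
      ContinuousAt f S → ContinuousAt g S → ContinuousAt (fun X => f X * g X) S :=
    fun hf hg => ((continuous_fst.matrix_mul continuous_snd).continuousAt).comp
      (hf.prodMk hg)
  exact h2.sub (mulc (mulc (mulc h3 h1) continuousAt_const) h2)

variable {A Q Sig : Matrix (Fin n) (Fin n) ℂ}

theorem predictionCov_posSemidef (hR : R.PosDef) (hQ : Q.PosSemidef) (hSig : Sig.PosSemidef)
    (k : ℕ) : (predictionCov A C Q R Sig k).PosSemidef := by
  induction k with
  | zero => exact hSig
  | succ k ih =>
    exact ((measurementUpdate_posSemidef hR ih).mul_mul_conjTranspose_same A).add hQ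

theorem posSemidef_of_tendsto_errorCov (hR : R.PosDef) (hQ : Q.PosSemidef)
    (hSig : Sig.PosSemidef) {P : Matrix (Fin n) (Fin n) ℂ}
    (hP : Tendsto (errorCov A C Q R Sig) atTop (𝓝 P)) : P.PosSemidef :=
  tendsto_posSemidef
    (fun k => measurementUpdate_posSemidef hR (predictionCov_posSemidef hR hQ hSig k)) hP

/-- The limit of the error covariances solves the algebraic Riccati equation. -/
theorem measurementUpdate_limit (hR : R.PosDef) (hQ : Q.PosSemidef)
    (hSig : Sig.PosSemidef) {P : Matrix (Fin n) (Fin n) ℂ}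
    (hP : Tendsto (errorCov A C Q R Sig) atTop (𝓝 P)) :
    measurementUpdate C R (A * P * Aᴴ + Q) = P := by
  have hS : (A * P * Aᴴ + Q).PosSemidef :=
    ((posSemidef_of_tendsto_errorCov hR hQ hSig hP).mul_mul_conjTranspose_same A).add hQ
  have hc : Continuous fun X : Matrix (Fin n) (Fin n) ℂ => A * X * Aᴴ + Q := by fun_prop
  have h1 : Tendsto (fun k => measurementUpdate C R (A * errorCov A C Q R Sig k * Aᴴ + Q)) atTop
      (𝓝 (measurementUpdate C R (A * P * Aᴴ + Q))) :=
    (continuousAt_measurementUpdate hR hS).tendsto.comp ((hc.tendsto P).comp hP)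
  -- The updated sequence is, by definition, the error covariance shifted by one step.
  exact tendsto_nhds_unique h1 (hP.comp (tendsto_add_atTop_nat 1))

theorem steady_output_cov (hR : R.PosDef) (hS : S.PosSemidef) :
    C * measurementUpdate C R S = R * (kalmanGain C R S)ᴴ := by
  have h := congrArg Matrix.conjTranspose (kalmanGain_mul_cov (C := C) hR hS)
  rw [Matrix.conjTranspose_mul, Matrix.conjTranspose_mul, Matrix.conjTranspose_conjTranspose,
    (measurementUpdate_posSemidef hR hS).isHermitian.eq, hR.isHermitian.eq] at h
  exact h.symm

/-- The adjoint of P = (1 - KC)P₊. Having A on one side and the closed loop on the other, it becomes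
the Sylvester equation for GP after multiplication by G. -/
theorem steady_cross_cov {P : Matrix (Fin n) (Fin n) ℂ}
    (hQ : Q.PosSemidef) (hP : P.PosSemidef)
    (hfix : measurementUpdate C R (A * P * Aᴴ + Q) = P) {K : Matrix (Fin n) (Fin m) ℂ}
    (hK : K = kalmanGain C R (A * P * Aᴴ + Q)) :
    P = A * P * (A - K * C * A)ᴴ + Q * (1 - K * C)ᴴ := by
  have hS : (A * P * Aᴴ + Q).PosSemidef := (hP.mul_mul_conjTranspose_same A).add hQ
  have h := congrArg Matrix.conjTranspose hfix
  rw [measurementUpdate_eq, ← hK, Matrix.conjTranspose_mul, hS.isHermitian.eq,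
    hP.isHermitian.eq] at h
  have e : A - K * C * A = (1 - K * C) * A := by rw [sub_mul, one_mul]
  rw [e, Matrix.conjTranspose_mul, ← Matrix.mul_assoc, ← add_mul, h]

/-- The Joseph form at the fixed point; its forcing term contains KRK', from which stability of the
closed loop is deduced. -/
theorem steady_lyapunov {P : Matrix (Fin n) (Fin n) ℂ} (hR : R.PosDef)
    (hQ : Q.PosSemidef) (hP : P.PosSemidef)
    (hfix : measurementUpdate C R (A * P * Aᴴ + Q) = P) {K : Matrix (Fin n) (Fin m) ℂ}
    (hK : K = kalmanGain C R (A * P * Aᴴ + Q)) :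
    P = (A - K * C * A) * P * (A - K * C * A)ᴴ +
      ((1 - K * C) * Q * (1 - K * C)ᴴ + K * R * Kᴴ) := by
  have hS : (A * P * Aᴴ + Q).PosSemidef := (hP.mul_mul_conjTranspose_same A).add hQ
  have h := measurementUpdate_eq_joseph (C := C) hR hS
  rw [hfix, ← hK] at h
  have e : A - K * C * A = (1 - K * C) * A := by rw [sub_mul, one_mul]
  rw [e]
  conv_lhs => rw [h]
  rw [Matrix.conjTranspose_mul ((1 : Matrix (Fin n) (Fin n) ℂ) - K * C) A]
  simp only [mul_add, add_mul, Matrix.mul_assoc, add_assoc]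

end Kalman

/-! ### Optimality conditions of the convex problem -/

section Lasso

variable {n m : ℕ} {M : Matrix (Fin m × Fin n) (Fin m × Fin n) ℂ}
  {H : Matrix (Fin m × Fin n) (Fin n) ℂ} {Y μ : Fin m × Fin n → ℂ} {γ : ℝ} {x : Fin n → ℂ}

/-- Duality of the sup and ℓ¹ norms: such an `l` is a subgradient of γ‖·‖₁ at 0. -/
theorem re_star_dotProduct_le {ι : Type*} [Fintype ι] (l z : ι → ℂ) (hl : ‖l‖ ≤ γ) :
    (star l ⬝ᵥ z).re ≤ γ * ∑ p, ‖z p‖ := by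
  rw [dotProduct, Complex.re_sum, Finset.mul_sum]
  refine Finset.sum_le_sum fun p _ => (Complex.re_le_norm _).trans ?_
  rw [norm_mul, Pi.star_apply, norm_star]
  exact mul_le_mul_of_nonneg_right ((norm_le_pi_norm l p).trans hl) (norm_nonneg _)

theorem re_quadraticForm_add {ι : Type*} [Fintype ι] {B : Matrix ι ι ℂ} (hB : B.IsHermitian)
    (z d : ι → ℂ) : (star (z + d) ⬝ᵥ (B *ᵥ (z + d))).re =
      (star z ⬝ᵥ (B *ᵥ z)).re + 2 * (star (B *ᵥ z) ⬝ᵥ d).re + (star d ⬝ᵥ (B *ᵥ d)).re := by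
  have h1 : star z ⬝ᵥ (B *ᵥ d) = star (B *ᵥ z) ⬝ᵥ d := by
    rw [Matrix.star_mulVec, hB.eq, Matrix.dotProduct_mulVec]
  have h2 : star d ⬝ᵥ (B *ᵥ z) = star (star (B *ᵥ z) ⬝ᵥ d) := by
    rw [Matrix.star_dotProduct]
  rw [star_add, Matrix.mulVec_add, add_dotProduct, dotProduct_add, dotProduct_add, h1, h2]
  simp only [Complex.add_re, Complex.star_def, Complex.conj_re]
  ring

/-- The cost of a feasible triple, expanded around a stationary point with `ν = 0`. -/
theorem lassoCost_eq_add (hM : M.PosDef) (hY : Y = H *ᵥ x + μ)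
    (hstat : Hᴴ *ᵥ (M⁻¹ *ᵥ μ) = 0) {x' : Fin n → ℂ} {μ' ν' : Fin m × Fin n → ℂ}
    (hY' : Y = H *ᵥ x' + μ' + ν') :
    lassoCost M γ μ' ν' = lassoCost M γ μ 0 +
      1 / 2 * (star (μ' - μ) ⬝ᵥ (M⁻¹ *ᵥ (μ' - μ))).re +
      (γ * ∑ p, ‖ν' p‖ - (star (M⁻¹ *ᵥ μ) ⬝ᵥ ν').re) := by
  have hd : μ' - μ = H *ᵥ (x - x') - ν' := by
    rw [Matrix.mulVec_sub]
    rw [hY] at hY'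
    linear_combination -hY'
  have h0 : star (M⁻¹ *ᵥ μ) ⬝ᵥ (H *ᵥ (x - x')) = 0 := by
    rw [Matrix.dotProduct_mulVec, ← Matrix.conjTranspose_conjTranspose H, ← Matrix.star_mulVec,
      hstat, star_zero, zero_dotProduct]
  have h := re_quadraticForm_add hM.inv.isHermitian μ (μ' - μ)
  have h1 : (star (M⁻¹ *ᵥ μ) ⬝ᵥ (μ' - μ)).re = - (star (M⁻¹ *ᵥ μ) ⬝ᵥ ν').re := by
    rw [hd, dotProduct_sub, h0, zero_sub, Complex.neg_re]
  rw [add_sub_cancel, h1] at h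
  simp only [lassoCost, h, Pi.zero_apply, norm_zero, Finset.sum_const_zero, mul_zero, add_zero]
  ring

theorem isLassoSolution_of_stationary (hM : M.PosDef) (hY : Y = H *ᵥ x + μ)
    (hstat : Hᴴ *ᵥ (M⁻¹ *ᵥ μ) = 0) (hγ : ‖M⁻¹ *ᵥ μ‖ ≤ γ) :
    IsLassoSolution M H Y γ x μ 0 := by
  refine ⟨by rw [hY, add_zero], fun x' μ' ν' hY' => ?_⟩
  rw [lassoCost_eq_add hM hY hstat hY']
  have h1 := hM.inv.posSemidef.re_dotProduct_nonneg (μ' - μ)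
  have h2 := re_star_dotProduct_le (M⁻¹ *ᵥ μ) ν' hγ
  simp only [RCLike.re_to_complex] at h1
  linarith

theorem IsLassoSolution.eq_of_stationary (hM : M.PosDef) (hH : Function.Injective H.mulVec)
    (hY : Y = H *ᵥ x + μ) (hstat : Hᴴ *ᵥ (M⁻¹ *ᵥ μ) = 0) (hγ : ‖M⁻¹ *ᵥ μ‖ ≤ γ) (hpos : 0 < γ)
    {x' : Fin n → ℂ} {μ' ν' : Fin m × Fin n → ℂ} (h : IsLassoSolution M H Y γ x' μ' ν') :
    x' = x := by
  have hle := h.minimal x μ 0 (by rw [hY, add_zero])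
  have heq := lassoCost_eq_add (γ := γ) hM hY hstat h.feasible
  have h2 := re_star_dotProduct_le (M⁻¹ *ᵥ μ) ν' hγ
  -- A different `μ'` would add a strictly positive quadratic term, contradicting `hle`.
  have hμ : μ' = μ := by
    by_contra hne
    have := hM.inv.re_dotProduct_pos (sub_ne_zero.2 hne)
    simp only [RCLike.re_to_complex] at this
    linarith
  subst hμ
  -- With equal `μ` the two costs differ only by γ‖ν'‖₁.
  have hν : ∑ p, ‖ν' p‖ ≤ 0 := by
    simp only [lassoCost, Pi.zero_apply, norm_zero, Finset.sum_const_zero, mul_zero] at hle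
    exact nonpos_of_mul_nonpos_right (by linarith) hpos
  have hν' : ν' = 0 := by
    funext p
    have := (Finset.single_le_sum (fun q _ => norm_nonneg (ν' q)) (Finset.mem_univ p)).trans hν
    simpa using this
  have hf := h.feasible
  rw [hν', add_zero, hY] at hf
  exact hH (add_right_cancel hf).symm

end Lasso

/-! ### Sylvester and Lyapunov equations with diagonal coefficients -/

theorem diagonal_mul_mul_diagonal_conjTranspose_apply {ι κ : Type*} [Fintype ι] [Fintype κ]
    [DecidableEq ι] [DecidableEq κ] (f : ι → ℂ) (g : κ → ℂ) (X : Matrix ι κ ℂ) (p : ι) (q : κ) :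
    (Matrix.diagonal f * X * (Matrix.diagonal g)ᴴ) p q = f p * X p q * star (g q) := by
  rw [Matrix.diagonal_conjTranspose, Matrix.mul_diagonal, Matrix.diagonal_mul, Pi.star_apply]

section Lyapunov

variable {ι κ : Type*} [Fintype ι] [Fintype κ] [DecidableEq ι] [DecidableEq κ]

theorem mul_star_ne_one {a b : ℂ} (ha : ‖a‖ < 1) (hb : ‖b‖ < 1) : a * star b ≠ 1 := by
  intro h
  have h1 : ‖a * star b‖ = 1 := by rw [h, norm_one]
  rw [norm_mul, norm_star] at h1
  nlinarith [norm_nonneg a, norm_nonneg b]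

/-- The equation decouples into scalar ones, with coefficient 1 - f_p conj(g_q) ≠ 0. -/
theorem sylvester_unique {f : ι → ℂ} {g : κ → ℂ} (hf : ∀ p, ‖f p‖ < 1) (hg : ∀ q, ‖g q‖ < 1)
    {X Y B : Matrix ι κ ℂ} (hX : X = Matrix.diagonal f * X * (Matrix.diagonal g)ᴴ + B)
    (hY : Y = Matrix.diagonal f * Y * (Matrix.diagonal g)ᴴ + B) : X = Y := by
  ext p q
  have h1 := congrFun (congrFun hX p) q
  have h2 := congrFun (congrFun hY p) q
  rw [Matrix.add_apply, diagonal_mul_mul_diagonal_conjTranspose_apply] at h1 h2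
  refine mul_left_cancel₀ (sub_ne_zero.2 (mul_star_ne_one (hf p) (hg q)).symm) ?_
  linear_combination h1 - h2

theorem lyapunov_isHermitian {f : ι → ℂ} (hf : ∀ p, ‖f p‖ < 1) {W B : Matrix ι ι ℂ}
    (hB : B.IsHermitian) (hW : W = Matrix.diagonal f * W * (Matrix.diagonal f)ᴴ + B) :
    W.IsHermitian := by
  refine sylvester_unique (B := B) hf hf ?_ hW
  conv_lhs => rw [hW]
  rw [Matrix.conjTranspose_add, hB.eq, Matrix.conjTranspose_mul, Matrix.conjTranspose_mul,
    Matrix.conjTranspose_conjTranspose, Matrix.mul_assoc]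

/-- A solution of the Lyapunov equation is positive definite when no non-zero trajectory of
the adjoint dynamics stays in the kernel of the forcing term. -/
theorem lyapunov_posDef {f : ι → ℂ} (hf : ∀ p, ‖f p‖ < 1) {W B : Matrix ι ι ℂ}
    (hB : B.PosSemidef) (hW : W = Matrix.diagonal f * W * (Matrix.diagonal f)ᴴ + B)
    (hobs : ∀ z : ι → ℂ,
      (∀ t : ℕ, (star (fun p => star (f p) ^ t * z p) ⬝ᵥ
        (B *ᵥ fun p => star (f p) ^ t * z p)).re = 0) → z = 0) : W.PosDef := by
  have hherm := lyapunov_isHermitian hf hB.isHermitian hW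
  refine Matrix.PosDef.of_dotProduct_mulVec_pos hherm fun z hz => ?_
  have him : (star z ⬝ᵥ (W *ᵥ z)).im = 0 := hherm.im_star_dotProduct_mulVec_self z
  let zt : ℕ → ι → ℂ := fun t p => star (f p) ^ t * z p
  let q : ℕ → ℝ := fun t => (star (zt t) ⬝ᵥ (W *ᵥ zt t)).re
  let r : ℕ → ℝ := fun t => (star (zt t) ⬝ᵥ (B *ᵥ zt t)).re
  have hr : ∀ t, 0 ≤ r t := fun t => hB.re_dotProduct_nonneg (zt t)
  -- The form of `W` along the adjoint trajectory `zt` drops by the forcing `r t` at each step; it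
  -- tends to 0, hence is non-negative throughout.
  have hstep : ∀ t, q t = q (t + 1) + r t := by
    intro t
    have e : zt (t + 1) = (Matrix.diagonal f)ᴴ *ᵥ zt t := by
      funext p
      rw [Matrix.diagonal_conjTranspose, Matrix.mulVec_diagonal]
      simp only [zt, Pi.star_apply]
      ring
    have e2 : star (zt t) ⬝ᵥ (W *ᵥ zt t) =
        star (zt (t + 1)) ⬝ᵥ (W *ᵥ zt (t + 1)) + star (zt t) ⬝ᵥ (B *ᵥ zt t) := by
      conv_lhs => rw [hW]
      rw [Matrix.add_mulVec, dotProduct_add, e, Matrix.star_mulVec,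
        Matrix.conjTranspose_conjTranspose, ← Matrix.mulVec_mulVec, ← Matrix.mulVec_mulVec,
        Matrix.dotProduct_mulVec]
    simp only [q, r]
    rw [e2, Complex.add_re]
  have hanti : Antitone q := antitone_nat_of_succ_le fun t => by
    have := hstep t
    have := hr t
    linarith
  have hlim : Tendsto q atTop (𝓝 0) := by
    have hz : Tendsto zt atTop (𝓝 0) := by
      refine tendsto_pi_nhds.2 fun p => ?_
      have := (tendsto_pow_atTop_nhds_zero_of_norm_lt_one
        (show ‖star (f p)‖ < 1 by rw [norm_star]; exact hf p)).mul_const (z p)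
      simpa [zt] using this
    have hc : Continuous fun u : ι → ℂ => (star u ⬝ᵥ (W *ᵥ u)).re :=
      Complex.continuous_re.comp
        (continuous_star.dotProduct (continuous_const.matrix_mulVec continuous_id))
    have := (hc.tendsto 0).comp hz
    simp only [star_zero, zero_dotProduct, Complex.zero_re] at this
    exact this
  have hnn : ∀ t, 0 ≤ q t := fun t => hanti.le_of_tendsto hlim t
  have hq0 : q 0 = (star z ⬝ᵥ (W *ᵥ z)).re := by simp [q, zt]
  have hpos : 0 < q 0 := by
    -- If `q 0 = 0`, then `q` vanishes identically and so does every drop `r t`.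
    refine lt_of_le_of_ne (hnn 0) fun h0 => hz (hobs z fun t => ?_)
    have h1 := hanti (Nat.zero_le t)
    have h2 := hstep t
    have h3 := hr t
    have h4 := hnn (t + 1)
    change r t = 0
    linarith
  rw [Complex.lt_def]
  exact ⟨by rw [← hq0]; exact hpos, him.symm⟩

end Lyapunov

/-! ### Block matrices and positive definiteness of W -/

section Blocks

variable {n m : ℕ}

/-- The matrix that repeats the `i`-th entry of a vector over the `i`-th block. -/
def blockRepeat (n m : ℕ) : Matrix (Fin m × Fin n) (Fin m) ℂ :=
  Matrix.of fun p i => if p.1 = i then 1 else 0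

theorem blockDiag_diagonal (pi : Fin n → ℂ) :
    blockDiag (fun _ : Fin m => Matrix.diagonal pi) =
      Matrix.diagonal fun p : Fin m × Fin n => pi p.2 := by
  ext p q
  simp only [blockDiag, Matrix.of_apply, Matrix.diagonal_apply, Prod.ext_iff]
  split_ifs <;> simp_all

theorem blockDiag_mulVec_apply (B : Fin m → Matrix (Fin n) (Fin n) ℂ) (u : Fin m × Fin n → ℂ)
    (i : Fin m) (j : Fin n) :
    (blockDiag B *ᵥ u) (i, j) = (B i *ᵥ fun s => u (i, s)) j := by
  simp only [blockDiag, Matrix.mulVec, dotProduct, Matrix.of_apply, Fintype.sum_prod_type,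
    ite_mul, zero_mul]
  rw [Finset.sum_eq_single i (fun b _ hb => by simp [hb.symm]) (by simp)]
  simp

theorem blockDiag_mulVec_stackVec (B : Fin m → Matrix (Fin n) (Fin n) ℂ)
    (u : Fin m → Fin n → ℂ) :
    blockDiag B *ᵥ stackVec u = stackVec fun i => B i *ᵥ u i := by
  funext ⟨i, j⟩
  rw [blockDiag_mulVec_apply]
  rfl

theorem blockDiag_mul_stackRows (B D : Fin m → Matrix (Fin n) (Fin n) ℂ) :
    blockDiag B * stackRows D = stackRows fun i => B i * D i := by
  ext ⟨i, j⟩ s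
  exact blockDiag_mulVec_apply B (fun p => stackRows D p s) i j

theorem blockDiag_mul_blockDiag (B D : Fin m → Matrix (Fin n) (Fin n) ℂ) :
    blockDiag B * blockDiag D = blockDiag fun i => B i * D i := by
  ext ⟨i, j⟩ ⟨i', s⟩
  refine (blockDiag_mulVec_apply B (fun p => blockDiag D p (i', s)) i j).trans ?_
  by_cases h : i = i'
  · simp [blockDiag, h, Matrix.mulVec, dotProduct, Matrix.mul_apply]
  · simp [blockDiag, h, Matrix.mulVec, dotProduct]

theorem blockDiag_one : blockDiag (fun _ : Fin m => (1 : Matrix (Fin n) (Fin n) ℂ)) = 1 := by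
  simp only [← Matrix.diagonal_one]
  exact blockDiag_diagonal _

theorem isUnit_blockDiag {T : Fin m → Matrix (Fin n) (Fin n) ℂ} (hT : ∀ i, IsUnit (T i).det) :
    IsUnit (blockDiag T) := by
  refine IsUnit.of_mul_eq_one (blockDiag fun i => (T i)⁻¹) ?_
  rw [blockDiag_mul_blockDiag, ← blockDiag_one]
  congr 1
  funext i
  exact Matrix.mul_nonsing_inv _ (hT i)

theorem stackVec_mulVec (B : Fin m → Matrix (Fin n) (Fin n) ℂ) (x : Fin n → ℂ) :
    (stackVec fun i => B i *ᵥ x) = stackRows B *ᵥ x := rfl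

theorem blockRepeat_mul_apply {κ : Type*} [Fintype κ] (X : Matrix (Fin m) κ ℂ) (p : Fin m × Fin n)
    (q : κ) : (blockRepeat n m * X) p q = X p.1 q := by
  simp [blockRepeat, Matrix.mul_apply]

theorem blockRepeat_mulVec (u : Fin m → ℂ) :
    blockRepeat n m *ᵥ u = stackVec fun i _ => u i := by
  funext p
  simp [blockRepeat, Matrix.mulVec, dotProduct, stackVec]

theorem blockRepeat_conjTranspose_mulVec (u : Fin m × Fin n → ℂ) (i : Fin m) :
    ((blockRepeat n m)ᴴ *ᵥ u) i = ∑ j, u (i, j) := by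
  simp only [blockRepeat, Matrix.mulVec, dotProduct, Matrix.conjTranspose_apply, Matrix.of_apply,
    Fintype.sum_prod_type]
  rw [Finset.sum_eq_single i (fun b _ hb => by simp [hb]) (by simp)]
  simp

theorem kronecker_ones_eq (R : Matrix (Fin m) (Fin m) ℂ) :
    R ⊗ₖ (Matrix.of fun _ _ => 1 : Matrix (Fin n) (Fin n) ℂ) =
      blockRepeat n m * R * (blockRepeat n m)ᴴ := by
  ext p q
  rw [Matrix.mul_assoc, blockRepeat_mul_apply]
  simp [blockRepeat, Matrix.mul_apply, Matrix.kroneckerMap_apply, apply_ite]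

theorem noiseCov_eq (A : Matrix (Fin n) (Fin n) ℂ) (C : Matrix (Fin m) (Fin n) ℂ)
    (Q : Matrix (Fin n) (Fin n) ℂ) (R : Matrix (Fin m) (Fin m) ℂ) (pi : Fin n → ℂ) :
    noiseCov A C Q R pi =
      (bigG A C pi - blockRepeat n m * C) * Q * (bigG A C pi - blockRepeat n m * C)ᴴ +
        blockRepeat n m * R * (blockRepeat n m)ᴴ := by
  have h : (stackRows fun i => sensorG A C pi i - Matrix.vecMulVec (fun _ => 1) (C i)) =
      bigG A C pi - blockRepeat n m * C := by
    ext p s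
    rw [Matrix.sub_apply, blockRepeat_mul_apply]
    simp [stackRows, bigG, Matrix.vecMulVec]
  simp only [noiseCov, h, kronecker_ones_eq]

theorem noiseCov_posSemidef {A : Matrix (Fin n) (Fin n) ℂ} {C : Matrix (Fin m) (Fin n) ℂ}
    {Q : Matrix (Fin n) (Fin n) ℂ} {R : Matrix (Fin m) (Fin m) ℂ} {pi : Fin n → ℂ}
    (hQ : Q.PosSemidef) (hR : R.PosSemidef) : (noiseCov A C Q R pi).PosSemidef := by
  rw [noiseCov_eq]
  exact (hQ.mul_mul_conjTranspose_same _).add (hR.mul_mul_conjTranspose_same _)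

/-- The R-part of the forcing sees only block sums. If these vanish along the whole adjoint
trajectory, a Vandermonde argument with the distinct π_j kills each block. -/
theorem stationaryCov_posDef {A : Matrix (Fin n) (Fin n) ℂ} {C : Matrix (Fin m) (Fin n) ℂ}
    {Q : Matrix (Fin n) (Fin n) ℂ} {R : Matrix (Fin m) (Fin m) ℂ} {pi : Fin n → ℂ}
    (hQ : Q.PosSemidef) (hR : R.PosDef) (hpi : Function.Injective pi) (hlt : ∀ j, ‖pi j‖ < 1)
    {W : Matrix (Fin m × Fin n) (Fin m × Fin n) ℂ}
    (hW : W = (Matrix.diagonal fun p : Fin m × Fin n => pi p.2) * W *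
      (Matrix.diagonal fun p : Fin m × Fin n => pi p.2)ᴴ + noiseCov A C Q R pi) : W.PosDef := by
  refine lyapunov_posDef (f := fun p : Fin m × Fin n => pi p.2) (fun p => hlt p.2)
    (noiseCov_posSemidef hQ hR.posSemidef) hW fun z hz => ?_
  have key : ∀ (t : ℕ) (i : Fin m), ∑ j, star (pi j) ^ t * z (i, j) = 0 := by
    intro t i
    set u : Fin m × Fin n → ℂ := fun p => star (pi p.2) ^ t * z p with hu
    have h := hz t
    rw [noiseCov_eq, Matrix.add_mulVec, dotProduct_add, Complex.add_re] at h
    have h1 := (hQ.mul_mul_conjTranspose_same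
      (bigG A C pi - blockRepeat n m * C)).re_dotProduct_nonneg u
    have h2 : star u ⬝ᵥ ((blockRepeat n m * R * (blockRepeat n m)ᴴ) *ᵥ u) =
        star ((blockRepeat n m)ᴴ *ᵥ u) ⬝ᵥ (R *ᵥ ((blockRepeat n m)ᴴ *ᵥ u)) := by
      rw [← Matrix.mulVec_mulVec, ← Matrix.mulVec_mulVec, Matrix.dotProduct_mulVec (star u),
        Matrix.star_mulVec, Matrix.conjTranspose_conjTranspose]
    rw [h2] at h
    simp only [RCLike.re_to_complex] at h1
    -- Both non-negative parts of the forcing vanish, and R is definite.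
    have h3 : (blockRepeat n m)ᴴ *ᵥ u = 0 := by
      by_contra hne
      have := hR.re_dotProduct_pos hne
      simp only [RCLike.re_to_complex] at this
      linarith
    have h4 := congrFun h3 i
    rwa [blockRepeat_conjTranspose_mulVec] at h4
  funext ⟨i, j⟩
  have hinj : Function.Injective fun j => star (pi j) := star_injective.comp hpi
  have := Matrix.eq_zero_of_forall_pow_sum_mul_pow_eq_zero (v := fun j => z (i, j)) hinj
    fun t => by simpa only [mul_comm] using key t i
  exact congrFun this j

end Blocks

/-! ### Local estimates, closed-loop stability and the gain F -/

section Dynamics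

variable {n m : ℕ} {A : Matrix (Fin n) (Fin n) ℂ} {C : Matrix (Fin m) (Fin n) ℂ}
  {V : Matrix (Fin n) (Fin n) ℂ} {K : Matrix (Fin n) (Fin m) ℂ} {pi : Fin n → ℂ}

theorem isUnit_sub_smul_one {B : Matrix (Fin n) (Fin n) ℂ} (hV : IsUnit V.det)
    (hB : B = V * Matrix.diagonal pi * V⁻¹) (hspec : Disjoint (spectrum ℂ A) (spectrum ℂ B))
    (j : Fin n) : IsUnit (A - pi j • (1 : Matrix (Fin n) (Fin n) ℂ)).det := by
  have h1 : pi j ∈ spectrum ℂ B := by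
    have h := spectrum.units_conjugate (R := ℂ) (a := Matrix.diagonal pi)
      (u := Matrix.nonsingInvUnit V hV)
    have e : (Matrix.nonsingInvUnit V hV : Matrix (Fin n) (Fin n) ℂ) * Matrix.diagonal pi *
        ((Matrix.nonsingInvUnit V hV)⁻¹ : (Matrix (Fin n) (Fin n) ℂ)ˣ) = B := by
      rw [hB]; rfl
    rw [e, spectrum_diagonal] at h
    rw [h]
    exact Set.mem_range_self j
  have h2 : pi j ∉ spectrum ℂ A := fun h => Set.disjoint_left.1 hspec h h1
  rw [spectrum.notMem_iff, ← IsUnit.neg_iff, neg_sub, Algebra.algebraMap_eq_smul_one] at h2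
  exact (Matrix.isUnit_iff_isUnit_det _).1 h2

/-- Row by row, this is the resolvent identity g_j(A - π_j) = C_i A. It removes the state from the
residue dynamics. -/
theorem bigG_mul (hres : ∀ j, IsUnit (A - pi j • (1 : Matrix (Fin n) (Fin n) ℂ)).det) :
    bigG A C pi * A = (Matrix.diagonal fun p : Fin m × Fin n => pi p.2) * bigG A C pi +
      blockRepeat n m * C * A := by
  ext ⟨i, j⟩ s
  rw [Matrix.add_apply, Matrix.diagonal_mul, Matrix.mul_assoc, blockRepeat_mul_apply,
    Matrix.mul_apply_eq_vecMul, Matrix.mul_apply_eq_vecMul]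
  have h : bigG A C pi (i, j) ᵥ* (A - pi j • (1 : Matrix (Fin n) (Fin n) ℂ)) = C i ᵥ* A := by
    change (C i ᵥ* (A * (A - pi j • (1 : Matrix (Fin n) (Fin n) ℂ))⁻¹)) ᵥ* _ = _
    rw [Matrix.vecMul_vecMul, Matrix.nonsing_inv_mul_cancel_right _ _ (hres j)]
  rw [Matrix.vecMul_sub, Matrix.vecMul_smul, Matrix.vecMul_one] at h
  have h' := congrFun h s
  simp only [Pi.sub_apply, Pi.smul_apply, smul_eq_mul] at h'
  linear_combination h'

theorem bigF_apply (r : Fin n) (p : Fin m × Fin n) :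
    bigF V K r p = V r p.2 * (V⁻¹ * K) p.2 p.1 := by
  simp only [bigF, stackCols, Matrix.of_apply, Matrix.mul_diagonal]
  rfl

theorem bigF_mul_blockRepeat (hV : IsUnit V.det) : bigF V K * blockRepeat n m = K := by
  have h : V * (V⁻¹ * K) = K := Matrix.mul_nonsing_inv_cancel_left _ _ hV
  ext r i
  conv_rhs => rw [← h]
  simp only [Matrix.mul_apply (M := bigF V K), Matrix.mul_apply (M := V), bigF_apply, blockRepeat,
    Matrix.of_apply, Fintype.sum_prod_type]
  rw [Finset.sum_eq_single i (fun b _ hb => by simp [hb]) (by simp)]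
  simp

/-- The blocks of V⁻¹F are diagonal and so commute with Π. -/
theorem bigF_mul_diagonal (hV : IsUnit V.det) :
    bigF V K * (Matrix.diagonal fun p : Fin m × Fin n => pi p.2) =
      V * Matrix.diagonal pi * V⁻¹ * bigF V K := by
  let F₀ : Matrix (Fin n) (Fin m × Fin n) ℂ :=
    Matrix.of fun r p => if r = p.2 then (V⁻¹ * K) p.2 p.1 else 0
  have h1 : bigF V K = V * F₀ := by
    ext r p
    rw [bigF_apply]
    simp [F₀, Matrix.mul_apply]
  have h2 : F₀ * (Matrix.diagonal fun p : Fin m × Fin n => pi p.2) = Matrix.diagonal pi * F₀ := by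
    ext r p
    rw [Matrix.mul_diagonal, Matrix.diagonal_mul]
    simp only [F₀, Matrix.of_apply]
    split_ifs with h
    · rw [h, mul_comm]
    · simp
  rw [h1, Matrix.mul_assoc V F₀, h2, Matrix.mul_assoc (V * Matrix.diagonal pi) V⁻¹,
    Matrix.nonsing_inv_mul_cancel_left _ _ hV, Matrix.mul_assoc]

/-- Y = FG - 1 satisfies YA = NY. Each row of V⁻¹Y is then annihilated by A - π_j, which is
invertible, so Y = 0. -/
theorem bigF_mul_bigG (hV : IsUnit V.det) (hdiag : A - K * C * A = V * Matrix.diagonal pi * V⁻¹)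
    (hres : ∀ j, IsUnit (A - pi j • (1 : Matrix (Fin n) (Fin n) ℂ)).det) :
    bigF V K * bigG A C pi = 1 := by
  have h1 : bigF V K * bigG A C pi * A =
      (A - K * C * A) * (bigF V K * bigG A C pi) + K * C * A := by
    rw [Matrix.mul_assoc, bigG_mul hres, Matrix.mul_add, ← Matrix.mul_assoc, bigF_mul_diagonal hV,
      ← hdiag, ← Matrix.mul_assoc, ← Matrix.mul_assoc, bigF_mul_blockRepeat hV, Matrix.mul_assoc]
  set Y := bigF V K * bigG A C pi - 1 with hYdef
  have h2 : Y * A = V * Matrix.diagonal pi * V⁻¹ * Y := by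
    rw [← hdiag, hYdef, sub_mul, h1, mul_sub, one_mul, mul_one]
    abel
  have h3 : V⁻¹ * Y * A = Matrix.diagonal pi * (V⁻¹ * Y) := by
    rw [Matrix.mul_assoc, h2, Matrix.mul_assoc, Matrix.mul_assoc,
      Matrix.nonsing_inv_mul_cancel_left _ _ hV]
  have h4 : V⁻¹ * Y = 0 := by
    funext j
    have h5 : (V⁻¹ * Y) j ᵥ* (A - pi j • (1 : Matrix (Fin n) (Fin n) ℂ)) = 0 := by
      rw [Matrix.vecMul_sub, ← Matrix.mul_apply_eq_vecMul, h3, Matrix.vecMul_smul,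
        Matrix.vecMul_one]
      funext s
      simp [Matrix.diagonal_mul]
    exact Matrix.eq_zero_of_vecMul_eq_zero (hres j).ne_zero h5
  have h6 : Y = 0 := by
    rw [← Matrix.mul_nonsing_inv_cancel_left V Y hV, h4, Matrix.mul_zero]
  exact sub_eq_zero.1 h6

/-- The closed-loop matrix of the Kalman filter is stable as soon as it shares no eigenvalue
with `A`. -/
theorem norm_closedLoop_eigenvalue_lt_one {P B : Matrix (Fin n) (Fin n) ℂ}
    {R : Matrix (Fin m) (Fin m) ℂ} (hV : IsUnit V.det)
    (hdiag : A - K * C * A = V * Matrix.diagonal pi * V⁻¹)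
    (hres : ∀ j, IsUnit (A - pi j • (1 : Matrix (Fin n) (Fin n) ℂ)).det)
    (hR : R.PosDef) (hP : P.PosSemidef) (hB : B.PosSemidef)
    (hlyap : P = (A - K * C * A) * P * (A - K * C * A)ᴴ + (B + K * R * Kᴴ)) (j : Fin n) :
    ‖pi j‖ < 1 := by
  by_contra! hge
  have hu : IsUnit V⁻¹.det := Matrix.isUnit_nonsing_inv_det V hV
  have hN : V⁻¹ * P * V⁻¹ᴴ = Matrix.diagonal pi * (V⁻¹ * P * V⁻¹ᴴ) * (Matrix.diagonal pi)ᴴ +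
      (V⁻¹ * B * V⁻¹ᴴ + V⁻¹ * K * R * (V⁻¹ * K)ᴴ) := by
    have e : V⁻¹ * (A - K * C * A) = Matrix.diagonal pi * V⁻¹ := by
      rw [hdiag, Matrix.mul_assoc, Matrix.nonsing_inv_mul_cancel_left _ _ hV]
    calc V⁻¹ * P * V⁻¹ᴴ = (V⁻¹ * (A - K * C * A)) * P * (V⁻¹ * (A - K * C * A))ᴴ +
          (V⁻¹ * B * V⁻¹ᴴ + V⁻¹ * K * R * (V⁻¹ * K)ᴴ) := by
          conv_lhs => rw [hlyap]
          rw [Matrix.conjTranspose_mul V⁻¹ (A - K * C * A), Matrix.conjTranspose_mul V⁻¹ K]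
          simp only [Matrix.mul_add, Matrix.add_mul, Matrix.mul_assoc]
      _ = _ := by
          rw [e, Matrix.conjTranspose_mul]
          simp only [Matrix.mul_assoc]
  have hjj := congrArg Complex.re (congrFun (congrFun hN j) j)
  rw [Matrix.add_apply, Matrix.add_apply, diagonal_mul_mul_diagonal_conjTranspose_apply] at hjj
  have h1 := (Complex.le_def.1 ((hP.mul_mul_conjTranspose_same V⁻¹).diag_nonneg (i := j))).1
  have h2 := (Complex.le_def.1 ((hB.mul_mul_conjTranspose_same V⁻¹).diag_nonneg (i := j))).1
  have e3 : (V⁻¹ * K * R * (V⁻¹ * K)ᴴ) j j =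
      star (star ((V⁻¹ * K) j)) ⬝ᵥ (R *ᵥ star ((V⁻¹ * K) j)) := by
    rw [star_star, Matrix.dotProduct_mulVec]
    rfl
  have h4 : pi j * (V⁻¹ * P * V⁻¹ᴴ) j j * star (pi j) =
      ((‖pi j‖ ^ 2 : ℝ) : ℂ) * (V⁻¹ * P * V⁻¹ᴴ) j j := by
    rw [← Complex.normSq_eq_norm_sq, ← Complex.mul_conj, Complex.star_def]
    ring
  rw [h4, e3, Complex.add_re, Complex.add_re, Complex.re_ofReal_mul] at hjj
  simp only [Complex.zero_re] at h1 h2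
  -- When |π_j| ≥ 1, the j-th diagonal entry of the Lyapunov equation leaves no room for a positive
  -- noise term, so the corresponding left eigenvector annihilates K.
  have hrow : (V⁻¹ * K) j = 0 := by
    by_contra hne
    have h5 := hR.re_dotProduct_pos (star_ne_zero.2 hne)
    simp only [RCLike.re_to_complex] at h5
    nlinarith [mul_nonneg (sub_nonneg.2 (one_le_pow₀ hge : (1 : ℝ) ≤ ‖pi j‖ ^ 2)) h1]
  -- A left eigenvector of N that annihilates K is one of A, with the same eigenvalue π_j.
  have h6 : V⁻¹ j ᵥ* (A - pi j • (1 : Matrix (Fin n) (Fin n) ℂ)) = 0 := by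
    have e : V⁻¹ * A = Matrix.diagonal pi * V⁻¹ + V⁻¹ * K * (C * A) := by
      have h7 : V⁻¹ * (A - K * C * A) = Matrix.diagonal pi * V⁻¹ := by
        rw [hdiag, Matrix.mul_assoc, Matrix.nonsing_inv_mul_cancel_left _ _ hV]
      rw [← h7, mul_sub]
      simp only [Matrix.mul_assoc]
      abel
    rw [Matrix.vecMul_sub, ← Matrix.mul_apply_eq_vecMul, e, Matrix.vecMul_smul, Matrix.vecMul_one]
    funext s
    rw [Pi.sub_apply, Matrix.add_apply, Matrix.diagonal_mul, Matrix.mul_apply_eq_vecMul, hrow]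
    simp
  have h8 := Matrix.eq_zero_of_vecMul_eq_zero (hres j).ne_zero h6
  exact hu.ne_zero (Matrix.det_eq_zero_of_row_eq_zero j (congrFun h8))

/-- The gain `F` combines the local estimates optimally: `W F' = G P`. -/
theorem stationaryCov_mul_bigF {P Q : Matrix (Fin n) (Fin n) ℂ} {R : Matrix (Fin m) (Fin m) ℂ}
    (hV : IsUnit V.det) (hdiag : A - K * C * A = V * Matrix.diagonal pi * V⁻¹)
    (hres : ∀ j, IsUnit (A - pi j • (1 : Matrix (Fin n) (Fin n) ℂ)).det)
    (hlt : ∀ j, ‖pi j‖ < 1)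
    (hcross : P = A * P * (A - K * C * A)ᴴ + Q * (1 - K * C)ᴴ) (hout : C * P = R * Kᴴ)
    {W : Matrix (Fin m × Fin n) (Fin m × Fin n) ℂ}
    (hW : W = (Matrix.diagonal fun p : Fin m × Fin n => pi p.2) * W *
      (Matrix.diagonal fun p : Fin m × Fin n => pi p.2)ᴴ + noiseCov A C Q R pi) :
    W * (bigF V K)ᴴ = bigG A C pi * P := by
  set F := bigF V K
  set G := bigG A C pi
  set E := blockRepeat n m
  set D := Matrix.diagonal fun p : Fin m × Fin n => pi p.2
  set N := A - K * C * A
  have hFG : F * G = 1 := bigF_mul_bigG hV hdiag hres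
  have hFE : F * E = K := bigF_mul_blockRepeat hV
  have hFD : F * D = N * F := by rw [hdiag]; exact bigF_mul_diagonal hV
  have hGA : G * A = D * G + E * C * A := bigG_mul hres
  have hnoise : noiseCov A C Q R pi * Fᴴ = (G - E * C) * Q * (1 - K * C)ᴴ + E * (C * P) := by
    have e1 : (G - E * C)ᴴ * Fᴴ = (1 - K * C)ᴴ := by
      rw [← Matrix.conjTranspose_mul, Matrix.mul_sub, hFG, ← Matrix.mul_assoc, hFE]
    have e2 : Eᴴ * Fᴴ = Kᴴ := by rw [← Matrix.conjTranspose_mul, hFE]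
    rw [noiseCov_eq, Matrix.add_mul, Matrix.mul_assoc _ (G - E * C)ᴴ, e1, Matrix.mul_assoc _ Eᴴ,
      e2, hout, Matrix.mul_assoc E]
  have h1 : W * Fᴴ = D * (W * Fᴴ) * Nᴴ + noiseCov A C Q R pi * Fᴴ := by
    have e : Dᴴ * Fᴴ = Fᴴ * Nᴴ := by
      rw [← Matrix.conjTranspose_mul, hFD, Matrix.conjTranspose_mul]
    conv_lhs => rw [hW]
    rw [Matrix.add_mul, Matrix.mul_assoc _ Dᴴ, e]
    simp only [Matrix.mul_assoc]
  have h2 : G * P = D * (G * P) * Nᴴ + noiseCov A C Q R pi * Fᴴ := by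
    have e1 : D * G = G * A - E * C * A := by rw [hGA, add_sub_cancel_right]
    have e2 : A * P * Nᴴ = P - Q * (1 - K * C)ᴴ := eq_sub_of_add_eq hcross.symm
    rw [hnoise, ← Matrix.mul_assoc D, e1]
    have e3 : (G * A - E * C * A) * P * Nᴴ = (G - E * C) * (A * P * Nᴴ) := by
      simp only [Matrix.sub_mul, Matrix.mul_assoc]
    rw [e3, e2]
    simp only [Matrix.sub_mul, Matrix.mul_sub, Matrix.mul_assoc]
    abel
  -- Multiplying by V⁻¹' on the right diagonalises N', which brings the equation into the scope of
  -- `sylvester_unique`.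
  have htrans : ∀ {X : Matrix (Fin m × Fin n) (Fin n) ℂ},
      X = D * X * Nᴴ + noiseCov A C Q R pi * Fᴴ →
      X * V⁻¹ᴴ = D * (X * V⁻¹ᴴ) * (Matrix.diagonal pi)ᴴ + noiseCov A C Q R pi * Fᴴ * V⁻¹ᴴ := by
    intro X hX
    have e : Nᴴ * V⁻¹ᴴ = V⁻¹ᴴ * (Matrix.diagonal pi)ᴴ := by
      rw [← Matrix.conjTranspose_mul, ← Matrix.conjTranspose_mul, hdiag, Matrix.mul_assoc,
        Matrix.nonsing_inv_mul_cancel_left _ _ hV]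
    conv_lhs => rw [hX]
    rw [Matrix.add_mul, Matrix.mul_assoc _ Nᴴ, e]
    simp only [Matrix.mul_assoc]
  have h3 := sylvester_unique (fun p : Fin m × Fin n => hlt p.2) hlt (htrans h1) (htrans h2)
  have h4 : V⁻¹ᴴ * Vᴴ = 1 := by
    rw [← Matrix.conjTranspose_mul, Matrix.mul_nonsing_inv _ hV, Matrix.conjTranspose_one]
  have h5 := congrArg (· * Vᴴ) h3
  simpa only [Matrix.mul_assoc, h4, Matrix.mul_one] using h5

/-- The hypotheses give P = FWF', which is definite because F has a right inverse, and P G' W⁻¹ = F.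
So P times the left side is F(1 - GF) = 0, and P cancels. -/
theorem conjTranspose_mul_inv_mul_sub_eq_zero {ι κ : Type*} [Fintype ι] [Fintype κ]
    [DecidableEq ι] [DecidableEq κ] {W : Matrix ι ι ℂ} {G : Matrix ι κ ℂ} {F : Matrix κ ι ℂ}
    {P : Matrix κ κ ℂ} (hW : W.PosDef) (hFG : F * G = 1) (hWF : W * Fᴴ = G * P) :
    Gᴴ * (W⁻¹ * (1 - G * F)) = 0 := by
  have hdet : IsUnit W.det := (Matrix.isUnit_iff_isUnit_det _).1 hW.isUnit
  have hP : P = F * W * Fᴴ := by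
    rw [Matrix.mul_assoc, hWF, ← Matrix.mul_assoc, hFG, Matrix.one_mul]
  have hPdef : P.PosDef := by
    rw [hP]
    refine hW.mul_mul_conjTranspose_same ?_
    have hinj : Function.LeftInverse (fun u => u ᵥ* G) (fun u => u ᵥ* F) := fun u => by
      simp only [Matrix.vecMul_vecMul, hFG, Matrix.vecMul_one]
    exact hinj.injective
  have hPdet : IsUnit P.det := (Matrix.isUnit_iff_isUnit_det _).1 hPdef.isUnit
  have h1 : P * (Gᴴ * W⁻¹) = F := by
    have h := congrArg Matrix.conjTranspose hWF
    rw [Matrix.conjTranspose_mul, Matrix.conjTranspose_conjTranspose, hW.isHermitian.eq,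
      Matrix.conjTranspose_mul, hPdef.isHermitian.eq] at h
    rw [← Matrix.mul_assoc, ← h, Matrix.mul_nonsing_inv_cancel_right _ _ hdet]
  have h2 : P * (Gᴴ * (W⁻¹ * (1 - G * F))) = 0 := by
    rw [← Matrix.mul_assoc Gᴴ, ← Matrix.mul_assoc P, h1, Matrix.mul_sub, Matrix.mul_one,
      ← Matrix.mul_assoc, hFG, Matrix.one_mul, sub_self]
  rw [← Matrix.nonsing_inv_mul_cancel_left P (Gᴴ * _) hPdet, h2, Matrix.mul_zero]

theorem bigF_mulVec_stackVec_eq (hV : IsUnit V.det)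
    (hdiag : A - K * C * A = V * Matrix.diagonal pi * V⁻¹) {y : ℕ → Fin m → ℂ}
    {xhat : ℕ → Fin n → ℂ}
    (hxhat : ∀ k, xhat (k + 1) = (A - K * C * A) *ᵥ xhat k + K *ᵥ y (k + 1))
    {ζ : ℕ → Fin m → Fin n → ℂ}
    (hζ : ∀ k i, ζ (k + 1) i = Matrix.diagonal pi *ᵥ ζ k i + fun _ => y (k + 1) i)
    (hinit : xhat 0 = bigF V K *ᵥ stackVec (ζ 0)) (k : ℕ) :
    xhat k = bigF V K *ᵥ stackVec (ζ k) := by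
  induction k with
  | zero => exact hinit
  | succ k ih =>
    have h : stackVec (ζ (k + 1)) = (Matrix.diagonal fun p : Fin m × Fin n => pi p.2) *ᵥ
        stackVec (ζ k) + blockRepeat n m *ᵥ y (k + 1) := by
      rw [blockRepeat_mulVec]
      funext p
      simp [stackVec, hζ, Matrix.mulVec_diagonal]
    rw [h, hxhat, ih, Matrix.mulVec_add, Matrix.mulVec_mulVec, Matrix.mulVec_mulVec,
      Matrix.mulVec_mulVec, bigF_mul_diagonal hV, bigF_mul_blockRepeat hV, hdiag]

end Dynamics

end SecureKalman

/-! ### Assembly of the theorem -/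

theorem mainTheorem4 {n m : ℕ}
    -- system matrices, noise covariances and initial covariance
    (A Q Sig : Matrix (Fin n) (Fin n) ℂ) (C : Matrix (Fin m) (Fin n) ℂ)
    (R : Matrix (Fin m) (Fin m) ℂ)
    (hAdet : IsUnit A.det) (hAjordan : SecureKalman.IsNonderogatoryJordan A)
    (hQ : Q.PosSemidef) (hR : R.PosDef) (hSig : Sig.PosSemidef)
    -- steady-state error covariance and Kalman gain
    (P : Matrix (Fin n) (Fin n) ℂ)
    (hP : Tendsto (SecureKalman.errorCov A C Q R Sig) atTop (𝓝 P))
    (K : Matrix (Fin n) (Fin m) ℂ)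
    (hK : K = SecureKalman.kalmanGain C R (A * P * Aᴴ + Q))
    -- `A - K C A` has `n` distinct eigenvalues, none of them an eigenvalue of `A`
    (V : Matrix (Fin n) (Fin n) ℂ) (pi : Fin n → ℂ)
    (hV : IsUnit V.det) (hpi : Function.Injective pi)
    (hdiag : A - K * C * A = V * Matrix.diagonal pi * V⁻¹)
    (hspec : Disjoint (spectrum ℂ A) (spectrum ℂ (A - K * C * A)))
    -- solution of the Lyapunov equation
    (W : Matrix (Fin m × Fin n) (Fin m × Fin n) ℂ)
    (hW : W = SecureKalman.blockDiag (fun _ => Matrix.diagonal pi) * W *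
        (SecureKalman.blockDiag (fun _ => Matrix.diagonal pi))ᴴ +
      SecureKalman.noiseCov A C Q R pi)
    -- invertible transformations to the canonical form
    (T : Fin m → Matrix (Fin n) (Fin n) ℂ) (hT : ∀ i, IsUnit (T i).det)
    (hTG : ∀ i, T i * SecureKalman.sensorG A C pi i = SecureKalman.sensorH A C i)
    (M : Matrix (Fin m × Fin n) (Fin m × Fin n) ℂ)
    (hM : M = SecureKalman.blockDiag T * W * (SecureKalman.blockDiag T)ᴴ)
    -- a realisation of the system, without attack
    (x w : ℕ → Fin n → ℂ) (y v a : ℕ → Fin m → ℂ)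
    (hx : ∀ k, x (k + 1) = A *ᵥ x k + w k)
    (hy : ∀ k, y k = C *ᵥ x k + v k + a k)
    (ha : ∀ k, a k = 0)
    -- the fixed-gain Kalman estimate and the local estimates, initialised consistently
    (xhat : ℕ → Fin n → ℂ)
    (hxhat : ∀ k, xhat (k + 1) = (A - K * C * A) *ᵥ xhat k + K *ᵥ y (k + 1))
    (ζ : ℕ → Fin m → Fin n → ℂ)
    (hζ : ∀ k i, ζ (k + 1) i = Matrix.diagonal pi *ᵥ ζ k i + fun _ => y (k + 1) i)
    (hinit : xhat 0 = SecureKalman.bigF V K *ᵥ SecureKalman.stackVec (ζ 0))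
    -- the residues
    (ε : ℕ → Fin m → Fin n → ℂ)
    (hε : ∀ k i, ε k i = ζ k i - SecureKalman.sensorG A C pi i *ᵥ x k)
    (k : ℕ) (γ : ℝ)
    (hγ : ‖M⁻¹ *ᵥ (SecureKalman.blockDiag T *ᵥ
        ((1 - SecureKalman.bigG A C pi * SecureKalman.bigF V K) *ᵥ
          SecureKalman.stackVec (ε k)))‖ ≤ γ) :
    (∃ μ ν : Fin m × Fin n → ℂ,
      SecureKalman.IsLassoSolution M (SecureKalman.bigH A C)
        (SecureKalman.stackVec fun i => T i *ᵥ ζ k i) γ (xhat k) μ ν) ∧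
    (0 < γ → ∀ (xtilde : Fin n → ℂ) (μ ν : Fin m × Fin n → ℂ),
      SecureKalman.IsLassoSolution M (SecureKalman.bigH A C)
        (SecureKalman.stackVec fun i => T i *ᵥ ζ k i) γ xtilde μ ν →
      xtilde = xhat k) := by
  have hPpsd := SecureKalman.posSemidef_of_tendsto_errorCov hR hQ hSig hP
  have hfix := SecureKalman.measurementUpdate_limit hR hQ hSig hP
  have hS : (A * P * Aᴴ + Q).PosSemidef := (hPpsd.mul_mul_conjTranspose_same A).add hQ
  have hres := SecureKalman.isUnit_sub_smul_one hV hdiag hspec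
  have hlt := SecureKalman.norm_closedLoop_eigenvalue_lt_one hV hdiag hres hR hPpsd
    (hQ.mul_mul_conjTranspose_same (1 - K * C)) (SecureKalman.steady_lyapunov hR hQ hPpsd hfix hK)
  have hout : C * P = R * Kᴴ := by
    have h := SecureKalman.steady_output_cov (C := C) hR hS
    rwa [hfix, ← hK] at h
  rw [SecureKalman.blockDiag_diagonal] at hW
  have hWpos := SecureKalman.stationaryCov_posDef hQ hR hpi hlt hW
  have hWF := SecureKalman.stationaryCov_mul_bigF hV hdiag hres hlt
    (SecureKalman.steady_cross_cov hQ hPpsd hfix hK) hout hW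
  have hFG := SecureKalman.bigF_mul_bigG hV hdiag hres
  have hxF := SecureKalman.bigF_mulVec_stackVec_eq hV hdiag hxhat hζ hinit k
  have hTu := SecureKalman.isUnit_blockDiag hT
  have hH : SecureKalman.bigH A C = SecureKalman.blockDiag T * SecureKalman.bigG A C pi := by
    rw [SecureKalman.bigH, SecureKalman.bigG, SecureKalman.blockDiag_mul_stackRows]
    simp only [hTG]
  have hY : (SecureKalman.stackVec fun i => T i *ᵥ ζ k i) =
      SecureKalman.blockDiag T *ᵥ SecureKalman.stackVec (ζ k) :=
    (SecureKalman.blockDiag_mulVec_stackVec T (ζ k)).symm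
  have hεζ : SecureKalman.stackVec (ζ k) =
      SecureKalman.stackVec (ε k) + SecureKalman.bigG A C pi *ᵥ x k := by
    rw [SecureKalman.bigG, ← SecureKalman.stackVec_mulVec]
    funext p
    simp [SecureKalman.stackVec, hε]
  rw [hY, hH, hxF]
  set F := SecureKalman.bigF V K
  set G := SecureKalman.bigG A C pi
  set B := SecureKalman.blockDiag T
  -- The true state drops out since (1 - GF)G = 0, so the bound on the residues is a bound on M⁻¹μ.
  have hres0 : (1 - G * F) *ᵥ SecureKalman.stackVec (ζ k) =
      (1 - G * F) *ᵥ SecureKalman.stackVec (ε k) := by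
    rw [hεζ, Matrix.mulVec_add, Matrix.mulVec_mulVec, Matrix.sub_mul, Matrix.one_mul,
      Matrix.mul_assoc, hFG, Matrix.mul_one, sub_self, Matrix.zero_mulVec, add_zero]
  rw [← hres0] at hγ
  have hBdet : IsUnit B.det := (Matrix.isUnit_iff_isUnit_det _).1 hTu
  have hMpos : M.PosDef := by
    rw [hM]
    exact hWpos.mul_mul_conjTranspose_same (Matrix.vecMul_injective_of_isUnit hTu)
  have hfeas : B *ᵥ SecureKalman.stackVec (ζ k) =
      (B * G) *ᵥ (F *ᵥ SecureKalman.stackVec (ζ k)) +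
        B *ᵥ ((1 - G * F) *ᵥ SecureKalman.stackVec (ζ k)) := by
    rw [Matrix.mulVec_mulVec, Matrix.mulVec_mulVec, ← Matrix.add_mulVec, Matrix.mul_sub,
      Matrix.mul_one, Matrix.mul_assoc, add_sub_cancel]
  have hstat : (B * G)ᴴ *ᵥ (M⁻¹ *ᵥ (B *ᵥ ((1 - G * F) *ᵥ SecureKalman.stackVec (ζ k)))) = 0 := by
    have hBc : Bᴴ * Bᴴ⁻¹ = 1 := by
      refine Matrix.mul_nonsing_inv _ ?_
      rw [Matrix.det_conjTranspose]
      exact hBdet.star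
    have e : (B * G)ᴴ * (M⁻¹ * (B * (1 - G * F))) = Gᴴ * (W⁻¹ * (1 - G * F)) := by
      rw [hM, Matrix.mul_inv_rev, Matrix.mul_inv_rev, Matrix.conjTranspose_mul]
      simp only [Matrix.mul_assoc]
      rw [Matrix.nonsing_inv_mul_cancel_left B _ hBdet, ← Matrix.mul_assoc Bᴴ, hBc, Matrix.one_mul]
    simp only [Matrix.mulVec_mulVec]
    rw [e, SecureKalman.conjTranspose_mul_inv_mul_sub_eq_zero hWpos hFG hWF, Matrix.zero_mulVec]
  -- FG = 1 makes F B⁻¹ a left inverse of H = BG.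
  have hinj : Function.Injective (B * G).mulVec := by
    have hleft : Function.LeftInverse (F * B⁻¹).mulVec (B * G).mulVec := fun u => by
      rw [Matrix.mulVec_mulVec, Matrix.mul_assoc, Matrix.nonsing_inv_mul_cancel_left B _ hBdet, hFG,
        Matrix.one_mulVec]
    exact hleft.injective
  exact ⟨⟨_, 0, SecureKalman.isLassoSolution_of_stationary hMpos hfeas hstat hγ⟩,
    fun hpos xtilde μ ν hsol => hsol.eq_of_stationary hMpos hinj hfeas hstat hγ hpos⟩
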